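/- Let $1\le p<2$. Let $L$ be a slowly varying function, i.e. $L$ is real-valued, positive and measurable on some $[A,\infty)$, $A\ge 0$, and $\lim_{x\to\infty}L(\lambda x)/L(x)=1$ for every $\lambda>0$; let $\tilde L$ be its de Bruijn conjugate, i.e. a slowly varying function (unique up to asymptotic equivalence) with $$\lim_{x\to\infty}L(x)\,\tilde L(xL(x))=1\quad\text{and}\quad \lim_{x\to\infty}\tilde L(x)\,L(x\tilde L(x))=1 .$$ In the case $p=1$ assume further that $L$ is nondecreasing on $[0,\infty)$ and $L(x)\ge 1$ for all $x\ge 0$. Let $\{X_{n,i},\,1\le i\le n,\,n\ge1\}$ be a triangular array of random variables on a probability space, and for $a>0$ put $$X_{n,i}^{(a)}=-a\mathbf 1(X_{n,i}<-a)+X_{n,i}\mathbf 1(|X_{n,i}|\le a)+a\mathbf 1(X_{n,i}>a).$$ Suppose that the rows satisfy condition $(H)$ with a universal constant: there is a constant $C$, depending neither on $a$ nor on the row $N$, such that for all $a>0$, $N\ge1$, $m\ge0$, $n\ge1$ with $m+n\le N$, $$\mathbb E\Big(\max_{1\le k\le n}\Big|\sum_{i=m+1}^{m+k}\big(X_{N,i}^{(a)}-\mathbb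 E X_{N,i}^{(a)}\big)\Big|\Big)^2\le C\sum_{i=m+1}^{m+n}\mathbb E\big(X_{N,i}^{(a)}\big)^2 .$$ Suppose also that $\{|X_{n,i}|^pL(|X_{n,i}|^p),\,1\le i\le n,\,n\ge1\}$ is uniformly integrable in the Cesàro sense, that is, $$\lim_{a\to\infty}\sup_{n\ge1}\frac1n\sum_{i=1}^n\mathbb E\big(|X_{n,i}|^pL(|X_{n,i}|^p)\mathbf 1(|X_{n,i}|>a)\big)=0 .$$ Then every $X_{n,i}$ ($1\le i\le n$) is integrable, and $$\frac{1}{n^{1/p}\,\tilde L^{1/p}(n)}\max_{j\le n}\Big|\sum_{i=1}^j\big(X_{n,i}-\mathbb E X_{n,i}\big)\Big|\longrightarrow 0\quad\text{in probability as } n\to\infty .$$ -/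

import Mathlib

open MeasureTheory Filter Topology
open scoped ENNReal

noncomputable section

/-- `L` is slowly varying at infinity: positive and (Borel) measurable on some `[A, ∞)`, `A ≥ 0`,
with `L (l x) / L x → 1` as `x → ∞` for every `l > 0`.  Values of `L` below `A` are irrelevant. -/
def SlowlyVarying (L : ℝ → ℝ) : Prop :=
  (∃ A : ℝ, 0 ≤ A ∧ (∀ x, A ≤ x → 0 < L x) ∧ Measurable fun x : Set.Ici A => L x) ∧
    ∀ l : ℝ, 0 < l → Tendsto (fun x : ℝ => L (l * x) / L x) atTop (𝓝 1)

/-- `Lt` is a de Bruijn conjugate of `L` (such a function is unique up to asymptotic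
equivalence). -/
def IsDeBruijnConjugate (L Lt : ℝ → ℝ) : Prop :=
  SlowlyVarying Lt ∧
    Tendsto (fun x : ℝ => L x * Lt (x * L x)) atTop (𝓝 1) ∧
    Tendsto (fun x : ℝ => Lt x * L (x * Lt x)) atTop (𝓝 1)

/-- Truncation at level `a > 0`: `-a` for `x < -a`, `x` for `|x| ≤ a`, `a` for `x > a`. -/
def truncAt (a x : ℝ) : ℝ := max (-a) (min x a)

/-- `max_{1 ≤ k ≤ n} |y (m+1) + ⋯ + y (m+k)|` for `n ≥ 1`.  The index `k = 0` is included; it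
contributes the value `0`, which does not change a maximum of absolute values. -/
def maxAbsPartialSum (y : ℕ → ℝ) (m n : ℕ) : ℝ :=
  (Finset.range (n + 1)).sup' Finset.nonempty_range_add_one
    fun k => |∑ i ∈ Finset.Icc (m + 1) (m + k), y i|

/-- Condition (H), with constant `C`, for the collection `X 1, …, X N`: a maximal inequality for
the centred truncated variables of every block `m + 1, …, m + n`, at every truncation level. -/
def ConditionH {Ω : Type*} [MeasurableSpace Ω] (μ : Measure Ω) (N : ℕ) (X : ℕ → Ω → ℝ)
    (C : ℝ) : Prop :=
  ∀ a : ℝ, 0 < a → ∀ m n : ℕ, 1 ≤ n → m + n ≤ N →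
    ∫ ω, (maxAbsPartialSum
        (fun i => truncAt a (X i ω) - ∫ ω', truncAt a (X i ω') ∂μ) m n) ^ 2 ∂μ
      ≤ C * ∑ i ∈ Finset.Icc (m + 1) (m + n), ∫ ω, (truncAt a (X i ω)) ^ 2 ∂μ

/-- Uniform integrability in the Cesàro sense of the triangular array
`|X n i| ^ p * L (|X n i| ^ p)`, `1 ≤ i ≤ n`:
`sup_{n ≥ 1} n⁻¹ ∑_{i ≤ n} E (|X n i| ^ p L (|X n i| ^ p) 1 (|X n i| > a)) → 0` as `a → ∞`.
The expectations are `[0, ∞]`-valued. -/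
def CesaroUniformlyIntegrable {Ω : Type*} [MeasurableSpace Ω] (μ : Measure Ω) (p : ℝ)
    (L : ℝ → ℝ) (X : ℕ → ℕ → Ω → ℝ) : Prop :=
  Tendsto
    (fun a : ℝ => ⨆ (n : ℕ) (_ : 1 ≤ n), (n : ℝ≥0∞)⁻¹ *
      ∑ i ∈ Finset.Icc 1 n,
        ∫⁻ ω in {ω | a < |X n i ω|},
          ENNReal.ofReal (|X n i ω| ^ p * L (|X n i ω| ^ p)) ∂μ)
    atTop (𝓝 0)

end

/-! Put `G x = x ^ p * L (x ^ p)` and `b n = n ^ (1 / p) * Lt n ^ (1 / p)`. The conjugate relation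
makes `G (b n)` asymptotic to `n`; only `n ≤ 2 * G (b n)` is used. Truncate row `n` at `b n`.
Condition (H) bounds the centred truncated part in L², the remainder is bounded in L¹, and Markov's
inequality finishes. It remains to show that the sum of truncated second moments is `o(b n ^ 2)` and
that the sum of remainders is `o(b n)`. Both follow from the growth of `G`: up to a constant, `G x /
x ^ 2` decreases and `G x / x` increases (Potter bounds, or monotonicity of `L` when `p = 1`). Hence
above a fixed level `a` the two quantities are at most `K * b ^ 2 * G |X| / G b` and `K * b * G |X|
/ G b`. Cesàro uniform integrability makes the sum of the means of `G |X|` over `|X| > a` at most `n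
* ε ≤ 2 * ε * G (b n)`. The values below `a` contribute at most `n * a ^ 2`, which is `o(b n ^ 2)`
because `p < 2`. -/

/-! ### Slowly varying functions. -/

/-- Uniform convergence theorem: a measurable function whose increments vanish at infinity has
uniformly vanishing increments over the steps in `[0, 1]`. -/
theorem exists_forall_abs_increment_le {h : ℝ → ℝ} (hm : Measurable h)
    (hs : ∀ s, Tendsto (fun t => h (t + s) - h t) atTop (𝓝 0)) {ε : ℝ} (hε : 0 < ε) :
    ∃ T, ∀ t, T ≤ t → ∀ s ∈ Set.Icc (0 : ℝ) 1, |h (t + s) - h t| ≤ ε := by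
  set E : ℝ → Set ℝ := fun t => {u | u ∈ Set.Icc (0 : ℝ) 2 ∧ ε / 2 ≤ |h (t + u) - h t|} with hE
  have hmeas : ∀ t, MeasurableSet (E t) := fun t =>
    measurableSet_Icc.inter (measurableSet_le measurable_const
      (((hm.comp (measurable_const_add t)).sub_const _).abs))
  have hlim : Tendsto (fun t => volume (E t)) atTop (𝓝 0) := by
    have := tendsto_measure_of_tendsto_indicator (μ := (volume : Measure ℝ)) (L := atTop)
      (As := E) (A := ∅) (B := Set.Icc 0 2) hmeas measurableSet_Icc (by simp)
      (Eventually.of_forall fun t u hu => hu.1) (fun u => by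
        have h1 := (hs u).abs.eventually (gt_mem_nhds (show |(0 : ℝ)| < ε / 2 by simpa using hε))
        filter_upwards [h1] with t ht
        simp only [hE, Set.mem_ofPred_eq, Set.mem_empty_iff_false, iff_false, not_and, not_le]
        exact fun _ => ht)
    simpa using this
  obtain ⟨T, hT⟩ := eventually_atTop.1
    (hlim.eventually (gt_mem_nhds (show (0 : ℝ≥0∞) < 1 / 2 by simp)))
  refine ⟨T, fun t ht s hs => ?_⟩
  -- The two bad sets have total measure below 1, while `[s, 2]` has length at least 1. A point `u`
  -- outside both makes `h (t + u)` close to both `h t` and `h (t + s)`.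
  obtain ⟨u, hu, hu'⟩ : ∃ u ∈ Set.Icc s 2, u ∉ E t ∪ (fun v => v + -s) ⁻¹' E (t + s) := by
    by_contra! hcon
    have h1 : volume (Set.Icc s 2) ≤ volume (E t) + volume (E (t + s)) := by
      refine (measure_mono hcon).trans ((measure_union_le _ _).trans ?_)
      rw [measure_preimage_add_right]
    have h2 : volume (E t) + volume (E (t + s)) < 1 / 2 + 1 / 2 :=
      ENNReal.add_lt_add (hT t ht) (hT _ (by linarith [hs.1]))
    rw [ENNReal.add_halves] at h2
    have h3 : (1 : ℝ≥0∞) ≤ volume (Set.Icc s 2) := by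
      rw [Real.volume_Icc, ← ENNReal.ofReal_one]
      exact ENNReal.ofReal_le_ofReal (by linarith [hs.2])
    exact absurd (h3.trans h1) (not_le.2 h2)
  simp only [hE, Set.mem_union, Set.mem_preimage, Set.mem_ofPred_eq, not_or, not_and, not_le] at hu'
  have h1 := hu'.1 ⟨hs.1.trans hu.1, hu.2⟩
  have h2 := hu'.2 ⟨by linarith [hu.1], by linarith [hu.2, hs.1]⟩
  rw [show t + s + (u + -s) = t + u by ring] at h2
  rw [abs_lt] at h1 h2
  rw [abs_le]
  constructor <;> linarith

/-- Unit steps cost `ε` each; the extra 1 pays for the last fractional step. -/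
theorem exists_forall_abs_increment_le_mul {h : ℝ → ℝ} (hm : Measurable h)
    (hs : ∀ s, Tendsto (fun t => h (t + s) - h t) atTop (𝓝 0)) {ε : ℝ} (hε : 0 < ε) :
    ∃ T, ∀ t, T ≤ t → ∀ s, 0 ≤ s → |h (t + s) - h t| ≤ ε * (s + 1) := by
  obtain ⟨T, hT⟩ := exists_forall_abs_increment_le hm hs hε
  have key : ∀ n : ℕ, ∀ t, T ≤ t → ∀ s : ℝ, 0 ≤ s → s ≤ n → |h (t + s) - h t| ≤ ε * (s + 1) := by
    intro n
    induction n with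
    | zero =>
      intro t _ s h0 h1
      obtain rfl : s = 0 := le_antisymm (by simpa using h1) h0
      simpa using hε.le
    | succ n ih =>
      intro t ht s h0 h1
      rcases le_total s 1 with h2 | h2
      · exact (hT t ht s ⟨h0, h2⟩).trans (by nlinarith)
      · have h3 := ih (t + 1) (by linarith) (s - 1) (by linarith) (by push_cast at h1; linarith)
        have h4 := hT t ht 1 ⟨by norm_num, le_rfl⟩
        rw [show t + 1 + (s - 1) = t + s by ring] at h3
        calc |h (t + s) - h t| = |(h (t + s) - h (t + 1)) + (h (t + 1) - h t)| := by ring_nf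
          _ ≤ _ := abs_add_le _ _
          _ ≤ _ := add_le_add h3 h4
          _ = _ := by ring
  refine ⟨T, fun t ht s h0 => ?_⟩
  obtain ⟨n, hn⟩ := exists_nat_ge s
  exact key n t ht s h0 hn

/-- A slowly varying function coincides near infinity with a measurable function that is positive
everywhere. -/
theorem SlowlyVarying.exists_measurable_pos {L : ℝ → ℝ} (hL : SlowlyVarying L) :
    ∃ A, 0 < A ∧ ∃ L' : ℝ → ℝ, Measurable L' ∧ (∀ x, 0 < L' x) ∧ ∀ x, A ≤ x → L' x = L x := by
  obtain ⟨⟨A, hA, hpos, hm⟩, -⟩ := hL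
  refine ⟨A + 1, by linarith, fun x => L (max x A),
    hm.comp (g := fun x : Set.Ici A => L x)
      (f := fun x : ℝ => (⟨max x A, le_max_right x A⟩ : Set.Ici A))
      ((measurable_id.max measurable_const).subtype_mk), fun x => hpos _ (le_max_right x A),
    fun x hx => ?_⟩
  simp only
  rw [max_eq_left (by linarith)]

/-- Potter bounds. -/
theorem SlowlyVarying.potter {L : ℝ → ℝ} (hL : SlowlyVarying L) {δ : ℝ} (hδ : 0 < δ) :
    ∃ T, 0 < T ∧ ∃ K, 1 ≤ K ∧ ∀ x y, T ≤ x → x ≤ y →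
      0 < L x ∧ L y ≤ K * (y / x) ^ δ * L x ∧ L x ≤ K * (y / x) ^ δ * L y := by
  obtain ⟨A, hA, L', hm, hpos, heq⟩ := hL.exists_measurable_pos
  set h : ℝ → ℝ := fun t => Real.log (L' (Real.exp t)) with hh
  have hhm : Measurable h := Real.measurable_log.comp (hm.comp Real.measurable_exp)
  have hs : ∀ s, Tendsto (fun t => h (t + s) - h t) atTop (𝓝 0) := by
    intro s
    have h1 := (hL.2 (Real.exp s) (Real.exp_pos s)).comp Real.tendsto_exp_atTop
    have h2 := h1.log one_ne_zero
    rw [Real.log_one] at h2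
    refine h2.congr' ?_
    filter_upwards [Real.tendsto_exp_atTop.eventually_ge_atTop A,
      (Real.tendsto_exp_atTop.comp (tendsto_atTop_add_const_right _ s tendsto_id)).eventually_ge_atTop
        A] with t h3 h4
    simp only [Function.comp_apply, id] at h4 ⊢
    rw [← Real.exp_add, add_comm s t, ← heq _ h3, ← heq _ h4,
      Real.log_div (hpos _).ne' (hpos _).ne']
  obtain ⟨T, hT⟩ := exists_forall_abs_increment_le_mul hhm hs hδ
  -- In logarithmic coordinates the bound is `δ * (log (y / x) + 1)`; its additive `δ` becomes the
  -- constant `exp δ`.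
  refine ⟨max A (Real.exp T), lt_max_of_lt_left hA, Real.exp δ, Real.one_le_exp hδ.le,
    fun x y hx hxy => ?_⟩
  have hx0 : 0 < x := hA.trans_le ((le_max_left _ _).trans hx)
  have hy0 := hx0.trans_le hxy
  have h1 := hT (Real.log x) ((Real.le_log_iff_exp_le hx0).2 ((le_max_right _ _).trans hx))
    (Real.log (y / x)) (Real.log_nonneg ((one_le_div hx0).2 hxy))
  have h2 : Real.log x + Real.log (y / x) = Real.log y := by
    rw [Real.log_div hy0.ne' hx0.ne']; ring
  simp only [hh, h2, Real.exp_log hx0, Real.exp_log hy0] at h1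
  rw [heq x ((le_max_left _ _).trans hx), heq y (((le_max_left _ _).trans hx).trans hxy)] at h1
  have hLx : 0 < L x := heq x ((le_max_left _ _).trans hx) ▸ hpos x
  have hLy : 0 < L y := heq y (((le_max_left _ _).trans hx).trans hxy) ▸ hpos y
  have h3 : Real.exp δ * (y / x) ^ δ = Real.exp (δ * (Real.log (y / x) + 1)) := by
    rw [Real.rpow_def_of_pos (div_pos hy0 hx0), ← Real.exp_add]; ring_nf
  rw [abs_le] at h1
  refine ⟨hLx, ?_, ?_⟩
  · rw [h3, ← Real.exp_log hLy, ← Real.exp_log hLx, ← Real.exp_add]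
    exact Real.exp_le_exp.2 (by linarith [h1.2])
  · rw [h3, ← Real.exp_log hLy, ← Real.exp_log hLx, ← Real.exp_add]
    exact Real.exp_le_exp.2 (by linarith [h1.1])

theorem SlowlyVarying.eventually_pos {L : ℝ → ℝ} (hL : SlowlyVarying L) :
    ∀ᶠ x in atTop, 0 < L x := by
  obtain ⟨⟨A, -, hpos, -⟩, -⟩ := hL
  filter_upwards [eventually_ge_atTop A] with x hx using hpos x hx

/-- Potter with exponent `δ / 2` leaves a spare factor `x ^ (-(δ / 2))`. -/
theorem SlowlyVarying.tendsto_rpow_neg_mul {L : ℝ → ℝ} (hL : SlowlyVarying L) {δ : ℝ}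
    (hδ : 0 < δ) : Tendsto (fun x => x ^ (-δ) * L x) atTop (𝓝 0) := by
  obtain ⟨T, hT0, K, hK, hP⟩ := hL.potter (half_pos hδ)
  have h1 : Tendsto (fun x : ℝ => K * L T * T ^ (-(δ / 2)) * x ^ (-(δ / 2))) atTop (𝓝 0) := by
    simpa using (tendsto_rpow_neg_atTop (half_pos hδ)).const_mul (K * L T * T ^ (-(δ / 2)))
  refine squeeze_zero' ?_ ?_ h1
  · filter_upwards [hL.eventually_pos, eventually_ge_atTop 0] with x hx h0
    positivity
  · filter_upwards [eventually_ge_atTop T] with x hx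
    have hx0 := hT0.trans_le hx
    have := (hP T x le_rfl hx).2.1
    calc x ^ (-δ) * L x ≤ x ^ (-δ) * (K * (x / T) ^ (δ / 2) * L T) := by gcongr
      _ = K * L T * T ^ (-(δ / 2)) * (x ^ (-δ) * x ^ (δ / 2)) := by
        rw [Real.div_rpow hx0.le hT0.le, Real.rpow_neg hT0.le]; ring
      _ = _ := by rw [← Real.rpow_add hx0]; ring_nf

theorem SlowlyVarying.tendsto_mul_atTop {L : ℝ → ℝ} (hL : SlowlyVarying L) :
    Tendsto (fun x => x * L x) atTop atTop := by
  obtain ⟨T, hT0, K, hK, hP⟩ := hL.potter (δ := 1 / 2) (by norm_num)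
  have hLT := (hP T T le_rfl le_rfl).1
  have hc : 0 < L T * T ^ (1 / 2 : ℝ) / K := by positivity
  refine tendsto_atTop_mono' _ ?_
    ((tendsto_rpow_atTop (y := 1 / 2) (by norm_num)).const_mul_atTop hc)
  filter_upwards [eventually_ge_atTop T] with x hx
  have hx0 := hT0.trans_le hx
  have h1 := (hP T x le_rfl hx).2.2
  rw [Real.div_rpow hx0.le hT0.le] at h1
  have h2 : x = x ^ (1 / 2 : ℝ) * x ^ (1 / 2 : ℝ) := by
    rw [← Real.rpow_add hx0]; norm_num
  have hs : 0 < x ^ (1 / 2 : ℝ) := by positivity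
  have hT : 0 < T ^ (1 / 2 : ℝ) := by positivity
  have h3 : L T * T ^ (1 / 2 : ℝ) / K ≤ x ^ (1 / 2 : ℝ) * L x := by
    rw [div_le_iff₀ (by linarith)]
    calc L T * T ^ (1 / 2 : ℝ) ≤ K * (x ^ (1 / 2 : ℝ) / T ^ (1 / 2 : ℝ)) * L x * T ^ (1 / 2 : ℝ) := by
          gcongr
      _ = _ := by field_simp
  calc _ ≤ (x ^ (1 / 2 : ℝ) * L x) * x ^ (1 / 2 : ℝ) := by gcongr
    _ = (x ^ (1 / 2 : ℝ) * x ^ (1 / 2 : ℝ)) * L x := by ring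
    _ = x * L x := by rw [← h2]

/-! ### The weight and the norming sequence. -/

/-- The weight `x ^ p * L (x ^ p)`, cut off below a large threshold, is measurable and controls the
truncated second moment and the first absolute moment above any truncation level. -/
theorem SlowlyVarying.exists_weight_bounds {p : ℝ} (hp1 : 1 ≤ p) (hp2 : p < 2) {L : ℝ → ℝ}
    (hL : SlowlyVarying L) (hLp : p = 1 → MonotoneOn L (Set.Ici 0)) :
    ∃ T, 0 < T ∧ ∃ K, 0 < K ∧
      (∀ x, T ≤ x → 0 < x ^ p * L (x ^ p)) ∧
      (∀ a, T ≤ a → Measurable ((Set.Ioi a).indicator fun x => x ^ p * L (x ^ p))) ∧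
      (∀ x b, T ≤ x → T ≤ b →
        min x b ^ 2 * (b ^ p * L (b ^ p)) ≤ K * b ^ 2 * (x ^ p * L (x ^ p))) ∧
      (∀ x b, T ≤ b → b ≤ x → x * (b ^ p * L (b ^ p)) ≤ K * b * (x ^ p * L (x ^ p))) := by
  have hp0 : 0 < p := by linarith
  obtain ⟨A, hA, L', hL'm, hL'pos, hL'eq⟩ := hL.exists_measurable_pos
  -- Applied to `p`-th powers, this exponent yields `(b / x) ^ (2 - p)`, exactly what compares `G b
  -- / b ^ 2` with `G x / x ^ 2`.
  obtain ⟨T₁, hT₁, K₁, hK₁, hP₁⟩ := hL.potter (δ := (2 - p) / p) (div_pos (by linarith) hp0)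
  obtain ⟨T₂, hT₂, K₂, hK₂, hP₂⟩ : ∃ T, 0 < T ∧ ∃ K, 1 ≤ K ∧ ∀ x b, T ≤ b ^ p → 0 < b → b ≤ x →
      x * (b ^ p * L (b ^ p)) ≤ K * b * (x ^ p * L (x ^ p)) := by
    -- The Potter exponent `(p - 1) / p` vanishes at `p = 1`, so there monotonicity of `L` takes its
    -- place.
    rcases hp1.eq_or_lt with h | h
    · subst h
      refine ⟨A, hA, 1, le_rfl, fun x b hb hb0 hbx => ?_⟩
      simp only [Real.rpow_one] at hb ⊢
      have := hLp rfl hb0.le (hb0.le.trans hbx) hbx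
      have hx0 := hb0.trans_le hbx
      calc x * (b * L b) = (x * b) * L b := by ring
        _ ≤ (x * b) * L x := by gcongr
        _ = _ := by ring
    · obtain ⟨T, hT, K, hK, hP⟩ := hL.potter (δ := (p - 1) / p) (div_pos (by linarith) hp0)
      refine ⟨T, hT, K, hK, fun x b hb hb0 hbx => ?_⟩
      have hx0 := hb0.trans_le hbx
      have h1 := (hP (b ^ p) (x ^ p) hb (by gcongr)).2.2
      rw [← Real.div_rpow hx0.le hb0.le, ← Real.rpow_mul (by positivity),
        mul_div_cancel₀ _ hp0.ne', Real.div_rpow hx0.le hb0.le, Real.rpow_sub_one hx0.ne',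
        Real.rpow_sub_one hb0.ne'] at h1
      have hb' : 0 < b ^ p := by positivity
      calc x * (b ^ p * L (b ^ p))
          ≤ x * (b ^ p * (K * (x ^ p / x / (b ^ p / b)) * L (x ^ p))) := by gcongr
        _ = _ := by field_simp
  set S := max (max T₁ T₂) A with hS
  have hS0 : 0 < S := lt_max_of_lt_right hA
  have hpow : ∀ x, S ^ (1 / p) ≤ x → 0 < x ∧ T₁ ≤ x ^ p ∧ T₂ ≤ x ^ p ∧ A ≤ x ^ p := by
    intro x hx
    have h0 : 0 < x := (Real.rpow_pos_of_pos hS0 _).trans_le hx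
    have h1 : S ≤ x ^ p := by
      calc S = (S ^ (1 / p)) ^ p := by
            rw [← Real.rpow_mul hS0.le, one_div_mul_cancel hp0.ne', Real.rpow_one]
        _ ≤ x ^ p := by gcongr
    exact ⟨h0, ((le_max_left _ _).trans (le_max_left _ _)).trans h1,
      ((le_max_right _ _).trans (le_max_left _ _)).trans h1, (le_max_right _ _).trans h1⟩
  have hpos : ∀ x, S ^ (1 / p) ≤ x → 0 < x ^ p * L (x ^ p) := by
    intro x hx
    obtain ⟨h0, -, -, h1⟩ := hpow x hx
    have := hL'eq _ h1 ▸ hL'pos (x ^ p)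
    positivity
  refine ⟨S ^ (1 / p), by positivity, max K₁ K₂, lt_max_of_lt_left (by linarith), hpos,
    fun a ha => ?_, fun x b hx hb => ?_, fun x b hb hbx => ?_⟩
  · have : (Set.Ioi a).indicator (fun x => x ^ p * L (x ^ p)) =
        (Set.Ioi a).indicator (fun x => x ^ p * L' (x ^ p)) := by
      refine Set.indicator_congr fun x hx => ?_
      rw [hL'eq _ (hpow x (ha.trans (le_of_lt hx))).2.2.2]
    rw [this]
    have hm : Measurable fun x : ℝ => x ^ p := measurable_id.pow_const p
    exact (hm.mul (hL'm.comp hm)).indicator measurableSet_Ioi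
  · obtain ⟨hx0, hx1, hx2, -⟩ := hpow x hx
    obtain ⟨hb0, hb1, hb2, -⟩ := hpow b hb
    have hGx := hpos x hx
    have hGb := hpos b hb
    rcases le_total x b with h | h
    · rw [min_eq_left h]
      obtain ⟨hLx, h1, -⟩ := hP₁ (x ^ p) (b ^ p) hx1 (by gcongr)
      rw [← Real.div_rpow hb0.le hx0.le, ← Real.rpow_mul (by positivity),
        mul_div_cancel₀ _ hp0.ne', Real.div_rpow hb0.le hx0.le, Real.rpow_sub hx0,
        Real.rpow_sub hb0] at h1
      norm_cast at h1
      calc x ^ 2 * (b ^ p * L (b ^ p))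
          ≤ x ^ 2 * (b ^ p * (K₁ * (b ^ 2 / b ^ p / (x ^ 2 / x ^ p)) * L (x ^ p))) := by gcongr
        _ = K₁ * b ^ 2 * (x ^ p * L (x ^ p)) := by
          have : 0 < b ^ p := by positivity
          field_simp
        _ ≤ _ := by gcongr; exact le_max_left _ _
    · rw [min_eq_right h]
      -- Since `b ^ 2 ≤ b * x`, the first-moment bound suffices here.
      calc b ^ 2 * (b ^ p * L (b ^ p)) = b * (b * (b ^ p * L (b ^ p))) := by ring
        _ ≤ b * (x * (b ^ p * L (b ^ p))) := by gcongr
        _ ≤ b * (K₂ * b * (x ^ p * L (x ^ p))) := by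
          gcongr b * ?_
          exact hP₂ x b hb2 hb0 h
        _ = K₂ * b ^ 2 * (x ^ p * L (x ^ p)) := by ring
        _ ≤ _ := by gcongr; exact le_max_right _ _
  · obtain ⟨hb0, hb1, hb2, -⟩ := hpow b hb
    have hGx := hpos x (hb.trans hbx)
    refine (hP₂ x b hb2 hb0 hbx).trans ?_
    gcongr
    exact le_max_right _ _

/-- The norming sequence `n ^ (1 / p) * Lt n ^ (1 / p)`. -/
theorem IsDeBruijnConjugate.norming {p : ℝ} (hp1 : 1 ≤ p) (hp2 : p < 2) {L Lt : ℝ → ℝ}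
    (hL : SlowlyVarying L) (hLt : IsDeBruijnConjugate L Lt) :
    Tendsto (fun x : ℝ => x ^ (1 / p) * Lt x ^ (1 / p)) atTop atTop ∧
    (∀ᶠ x : ℝ in atTop, x ≤ 2 * ((x ^ (1 / p) * Lt x ^ (1 / p)) ^ p *
      L ((x ^ (1 / p) * Lt x ^ (1 / p)) ^ p))) ∧
    Tendsto (fun x : ℝ => x / (x ^ (1 / p) * Lt x ^ (1 / p)) ^ 2) atTop (𝓝 0) := by
  have hp0 : 0 < p := by linarith
  obtain ⟨hs, -, hc⟩ := hLt
  have hinf := hs.tendsto_mul_atTop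
  have heq : ∀ᶠ x : ℝ in atTop, 0 < x ∧ 0 < Lt x ∧
      x ^ (1 / p) * Lt x ^ (1 / p) = (x * Lt x) ^ (1 / p) := by
    filter_upwards [eventually_gt_atTop 0, hs.eventually_pos] with x h0 h1
    exact ⟨h0, h1, (Real.mul_rpow h0.le h1.le).symm⟩
  have hle : ∀ᶠ x : ℝ in atTop, x ≤ 2 * ((x * Lt x) * L (x * Lt x)) := by
    filter_upwards [heq, hc.eventually (lt_mem_nhds (show (1 / 2 : ℝ) < 1 by norm_num))]
      with x ⟨h0, _, _⟩ h1
    nlinarith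
  refine ⟨?_, ?_, ?_⟩
  · refine ((tendsto_rpow_atTop (y := 1 / p) (by positivity)).comp hinf).congr' ?_
    filter_upwards [heq] with x hx
    exact hx.2.2.symm
  · filter_upwards [heq, hle] with x ⟨h0, h1, h2⟩ h3
    rwa [h2, ← Real.rpow_mul (by positivity), one_div_mul_cancel hp0.ne', Real.rpow_one]
  · have hδ : 0 < 2 / p - 1 := by rw [sub_pos, one_lt_div hp0]; exact hp2
    -- With `B = x * Lt x`, the quotient is at most `2 * B * L B / B ^ (2 / p)`.
    have h1 := ((hL.tendsto_rpow_neg_mul hδ).comp hinf).const_mul 2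
    rw [mul_zero] at h1
    refine squeeze_zero' ?_ ?_ h1
    · filter_upwards [eventually_ge_atTop 0] with x hx using by positivity
    · filter_upwards [heq, hle] with x ⟨h0, h1, h2⟩ h3
      have hB : 0 < x * Lt x := by positivity
      rw [h2, ← Real.rpow_natCast, ← Real.rpow_mul hB.le, div_le_iff₀ (by positivity)]
      simp only [Function.comp_apply]
      rw [show -(2 / p - 1) = 1 - 1 / p * (2 : ℕ) by push_cast; ring, Real.rpow_sub hB,
        Real.rpow_one]
      refine h3.trans_eq ?_
      have : 0 < (x * Lt x) ^ (1 / p * (2 : ℕ)) := by positivity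
      field_simp

/-! ### Truncation and maximal partial sums. -/

theorem measurable_truncAt (a : ℝ) : Measurable (truncAt a) :=
  measurable_const.max (measurable_id.min measurable_const)

theorem abs_truncAt {a : ℝ} (ha : 0 ≤ a) (x : ℝ) : |truncAt a x| = min |x| a := by
  unfold truncAt
  rcases abs_cases x with h | h <;> rcases abs_cases (max (-a) (min x a)) with h' | h' <;> grind

theorem abs_sub_truncAt {a : ℝ} (ha : 0 ≤ a) (x : ℝ) :
    |x - truncAt a x| = max (|x| - a) 0 := by
  unfold truncAt
  rcases abs_cases x with h | h <;> rcases abs_cases (x - max (-a) (min x a)) with h' | h' <;> grind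

section maxAbsPartialSum

theorem maxAbsPartialSum_nonneg (y : ℕ → ℝ) (m n : ℕ) : 0 ≤ maxAbsPartialSum y m n :=
  (abs_nonneg _).trans (Finset.le_sup' (fun k => |∑ i ∈ Finset.Icc (m + 1) (m + k), y i|)
    (Finset.mem_range.2 n.succ_pos))

theorem maxAbsPartialSum_le_add (y z : ℕ → ℝ) (m n : ℕ) :
    maxAbsPartialSum y m n ≤
      maxAbsPartialSum z m n + ∑ i ∈ Finset.Icc (m + 1) (m + n), |y i - z i| := by
  refine Finset.sup'_le _ _ fun k hk => ?_
  have h1 : |∑ i ∈ Finset.Icc (m + 1) (m + k), z i| ≤ maxAbsPartialSum z m n :=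
    Finset.le_sup' (fun k => |∑ i ∈ Finset.Icc (m + 1) (m + k), z i|) hk
  have h2 : ∑ i ∈ Finset.Icc (m + 1) (m + k), |y i - z i| ≤
      ∑ i ∈ Finset.Icc (m + 1) (m + n), |y i - z i| :=
    Finset.sum_le_sum_of_subset_of_nonneg
      (Finset.Icc_subset_Icc le_rfl (by have := Finset.mem_range.1 hk; omega))
      fun _ _ _ => abs_nonneg _
  calc |∑ i ∈ Finset.Icc (m + 1) (m + k), y i|
      = |∑ i ∈ Finset.Icc (m + 1) (m + k), z i + ∑ i ∈ Finset.Icc (m + 1) (m + k), (y i - z i)| := by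
        rw [← Finset.sum_add_distrib]; simp
    _ ≤ _ := (abs_add_le _ _).trans
      (add_le_add h1 ((Finset.abs_sum_le_sum_abs _ _).trans h2))

theorem maxAbsPartialSum_le_sum (y : ℕ → ℝ) (m n : ℕ) :
    maxAbsPartialSum y m n ≤ ∑ i ∈ Finset.Icc (m + 1) (m + n), |y i| := by
  have h := maxAbsPartialSum_le_add y 0 m n
  have h0 : maxAbsPartialSum 0 m n ≤ 0 := Finset.sup'_le _ _ fun k _ => by simp
  simp only [Pi.zero_apply, sub_zero] at h
  linarith

variable {Ω : Type*} [MeasurableSpace Ω]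

theorem measurable_maxAbsPartialSum {Y : ℕ → Ω → ℝ} {m n : ℕ}
    (hY : ∀ i ∈ Finset.Icc (m + 1) (m + n), Measurable (Y i)) :
    Measurable fun ω => maxAbsPartialSum (fun i => Y i ω) m n := by
  have := Finset.measurable_sup' (s := Finset.range (n + 1)) Finset.nonempty_range_add_one
    (f := fun k ω => |∑ i ∈ Finset.Icc (m + 1) (m + k), Y i ω|) fun k hk =>
      (Finset.measurable_sum _ fun i hi => hY i (Finset.Icc_subset_Icc le_rfl
        (by have := Finset.mem_range.1 hk; omega) hi)).abs
  convert this using 1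
  ext ω
  rw [Finset.sup'_apply]
  rfl

theorem integrable_maxAbsPartialSum {μ : Measure Ω} {Y : ℕ → Ω → ℝ} {m n : ℕ}
    (hY : ∀ i ∈ Finset.Icc (m + 1) (m + n), Measurable (Y i))
    (hYi : ∀ i ∈ Finset.Icc (m + 1) (m + n), Integrable (Y i) μ) :
    Integrable (fun ω => maxAbsPartialSum (fun i => Y i ω) m n) μ := by
  refine (integrable_finsetSum _ fun i hi => (hYi i hi).abs).mono'
    (measurable_maxAbsPartialSum hY).aestronglyMeasurable (Eventually.of_forall fun ω => ?_)
  rw [Real.norm_of_nonneg (maxAbsPartialSum_nonneg _ _ _)]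
  exact maxAbsPartialSum_le_sum _ _ _

end maxAbsPartialSum

/-! ### The maximal inequality after truncation. -/

section

variable {Ω : Type*} [MeasurableSpace Ω] {μ : Measure Ω} [IsProbabilityMeasure μ]

theorem integral_le_sqrt_integral_sq {f : Ω → ℝ} (hf : MemLp f 2 μ) :
    ∫ ω, f ω ∂μ ≤ √(∫ ω, f ω ^ 2 ∂μ) := by
  refine Real.le_sqrt_of_sq_le ?_
  have h1 := ProbabilityTheory.variance_nonneg f μ
  rw [ProbabilityTheory.variance_eq_sub hf] at h1
  simpa using h1

theorem integrable_truncAt {X : Ω → ℝ} (hX : Measurable X) {a : ℝ} (ha : 0 ≤ a) :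
    Integrable (fun ω => truncAt a (X ω)) μ :=
  Integrable.of_bound ((measurable_truncAt a).comp hX).aestronglyMeasurable a
    (Eventually.of_forall fun ω => by
      rw [Real.norm_eq_abs, abs_truncAt ha]; exact min_le_right _ _)

/-- Under condition (H), the expected maximum of the centred partial sums is controlled by
truncation at any level. -/
theorem ConditionH.integral_maxAbsPartialSum_le {n : ℕ} (hn : 1 ≤ n) {X : ℕ → Ω → ℝ} {C : ℝ}
    (hH : ConditionH μ n X C) (hX : ∀ i ∈ Finset.Icc 1 n, Measurable (X i))
    (hXi : ∀ i ∈ Finset.Icc 1 n, Integrable (X i) μ) {b : ℝ} (hb : 0 < b) :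
    ∫ ω, maxAbsPartialSum (fun i => X i ω - ∫ ω', X i ω' ∂μ) 0 n ∂μ ≤
      √(C * ∑ i ∈ Finset.Icc 1 n, ∫ ω, truncAt b (X i ω) ^ 2 ∂μ) +
        2 * ∑ i ∈ Finset.Icc 1 n, ∫ ω, |X i ω - truncAt b (X i ω)| ∂μ := by
  set Y : ℕ → Ω → ℝ := fun i ω => truncAt b (X i ω) with hY
  have hYm : ∀ i ∈ Finset.Icc (0 + 1) (0 + n), Measurable (fun ω => Y i ω - ∫ ω', Y i ω' ∂μ) := by
    intro i hi
    rw [zero_add, zero_add] at hi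
    exact ((measurable_truncAt b).comp (hX i hi)).sub_const _
  have hYi : ∀ i ∈ Finset.Icc 1 n, Integrable (Y i) μ :=
    fun i hi => integrable_truncAt (hX i hi) hb.le
  have hYi' : ∀ i ∈ Finset.Icc (0 + 1) (0 + n),
      Integrable (fun ω => Y i ω - ∫ ω', Y i ω' ∂μ) μ := by
    intro i hi
    rw [zero_add, zero_add] at hi
    exact (hYi i hi).sub (integrable_const _)
  have hdi : ∀ i ∈ Finset.Icc 1 n, Integrable (fun ω => |X i ω - Y i ω|) μ :=
    fun i hi => ((hXi i hi).sub (hYi i hi)).abs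
  have hMi := integrable_maxAbsPartialSum hYm hYi'
  -- Boundedness makes the square integrable, so the integral in (H) is not a default value.
  have hM2 : MemLp (fun ω => maxAbsPartialSum (fun i => Y i ω - ∫ ω', Y i ω' ∂μ) 0 n) 2 μ := by
    refine MemLp.of_bound hMi.aestronglyMeasurable (∑ i ∈ Finset.Icc 1 n, (b + |∫ ω', Y i ω' ∂μ|))
      (Eventually.of_forall fun ω => ?_)
    rw [Real.norm_of_nonneg (maxAbsPartialSum_nonneg _ _ _)]
    refine (maxAbsPartialSum_le_sum _ _ _).trans ?_
    rw [zero_add, zero_add]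
    refine Finset.sum_le_sum fun i _ => (abs_sub _ _).trans ?_
    gcongr
    rw [hY, abs_truncAt hb.le]
    exact min_le_right _ _
  have hsq := (integral_le_sqrt_integral_sq hM2).trans
    (Real.sqrt_le_sqrt (hH b hb 0 n hn (by omega)))
  rw [zero_add, zero_add] at hsq
  -- Replacing `X i` by `Y i` changes both the variable and its mean, whence the factor 2 after
  -- integration.
  have hpt : ∀ ω, maxAbsPartialSum (fun i => X i ω - ∫ ω', X i ω' ∂μ) 0 n ≤
      maxAbsPartialSum (fun i => Y i ω - ∫ ω', Y i ω' ∂μ) 0 n +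
        ∑ i ∈ Finset.Icc 1 n, (|X i ω - Y i ω| + ∫ ω', |X i ω' - Y i ω'| ∂μ) := by
    intro ω
    refine (maxAbsPartialSum_le_add _ (fun i => Y i ω - ∫ ω', Y i ω' ∂μ) 0 n).trans ?_
    rw [zero_add, zero_add]
    gcongr with i hi
    rw [show X i ω - ∫ ω', X i ω' ∂μ - (Y i ω - ∫ ω', Y i ω' ∂μ) =
      (X i ω - Y i ω) - (∫ ω', X i ω' ∂μ - ∫ ω', Y i ω' ∂μ) by ring,
      ← integral_sub (hXi i hi) (hYi i hi)]
    exact (abs_sub _ _).trans (add_le_add le_rfl abs_integral_le_integral_abs)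
  have hsi : ∀ i ∈ Finset.Icc 1 n,
      Integrable (fun ω => |X i ω - Y i ω| + ∫ ω', |X i ω' - Y i ω'| ∂μ) μ :=
    fun i hi => (hdi i hi).add (integrable_const _)
  refine (integral_mono_of_nonneg
    (Eventually.of_forall fun ω => maxAbsPartialSum_nonneg _ _ _)
    (hMi.add (integrable_finsetSum _ hsi)) (Eventually.of_forall hpt)).trans ?_
  simp only [Pi.add_apply]
  rw [integral_add hMi (integrable_finsetSum _ hsi), integral_finsetSum _ hsi]
  refine add_le_add hsq ?_
  rw [Finset.mul_sum]
  refine Finset.sum_le_sum fun i hi => ?_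
  rw [integral_add (hdi i hi) (integrable_const _)]
  simp [two_mul, hY]

end

/-! ### Moment bounds from the weight, and convergence in probability. -/

section

variable {Ω : Type*} [MeasurableSpace Ω] {μ : Measure Ω}

section weight

variable {G : ℝ → ℝ} {T K a b : ℝ} {X : Ω → ℝ}

theorem indicator_Ioi_nonneg (hG : ∀ x, T ≤ x → 0 < G x) (ha : T ≤ a) (x : ℝ) :
    0 ≤ (Set.Ioi a).indicator G x :=
  Set.indicator_nonneg (fun y hy => (hG y (ha.trans (le_of_lt hy))).le) x

theorem integrable_of_integrable_weight [IsFiniteMeasure μ] (hT : 0 < T) (hK : 0 < K) (hG : ∀ x, T ≤ x → 0 < G x)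
    (h1 : ∀ x b, T ≤ b → b ≤ x → x * G b ≤ K * b * G x) (ha : T ≤ a) (hX : Measurable X)
    (hi : Integrable (fun ω => (Set.Ioi a).indicator G |X ω|) μ) : Integrable X μ := by
  refine ((integrable_const a).add (hi.const_mul (K * a / G a))).mono' hX.aestronglyMeasurable
    (Eventually.of_forall fun ω => ?_)
  simp only [Pi.add_apply, Real.norm_eq_abs]
  have hGa := hG a ha
  have ha0 := hT.trans_le ha
  rcases le_or_gt |X ω| a with h | h
  · have := indicator_Ioi_nonneg hG ha |X ω|
    have : 0 ≤ K * a / G a * (Set.Ioi a).indicator G |X ω| := by positivity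
    linarith
  · rw [Set.indicator_of_mem (Set.mem_Ioi.2 h), div_mul_eq_mul_div]
    have := (le_div_iff₀ hGa).2 (h1 _ _ ha h.le)
    linarith

/-- Where `|X| ≤ a` the square is at most `a ^ 2`; elsewhere the weight dominates it. -/
theorem integral_truncAt_sq_le [IsProbabilityMeasure μ] (hT : 0 < T) (hK : 0 < K) (hG : ∀ x, T ≤ x → 0 < G x)
    (h2 : ∀ x b, T ≤ x → T ≤ b → min x b ^ 2 * G b ≤ K * b ^ 2 * G x) (ha : T ≤ a) (hb : T ≤ b)
    (hi : Integrable (fun ω => (Set.Ioi a).indicator G |X ω|) μ) :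
    ∫ ω, truncAt b (X ω) ^ 2 ∂μ ≤
      a ^ 2 + K * b ^ 2 / G b * ∫ ω, (Set.Ioi a).indicator G |X ω| ∂μ := by
  have hGb := hG b hb
  have ha0 := hT.trans_le ha
  have hb0 := hT.trans_le hb
  have hint := hi.const_mul (K * b ^ 2 / G b)
  refine (integral_mono_of_nonneg (Eventually.of_forall fun ω => sq_nonneg _)
    ((integrable_const (a ^ 2)).add hint) (Eventually.of_forall fun ω => ?_)).trans_eq ?_
  · simp only [Pi.add_apply]
    rw [← sq_abs, abs_truncAt hb0.le]
    rcases le_or_gt |X ω| a with h | h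
    · have := indicator_Ioi_nonneg hG ha |X ω|
      have h3 : 0 ≤ K * b ^ 2 / G b * (Set.Ioi a).indicator G |X ω| := by positivity
      have h4 : min |X ω| b ^ 2 ≤ a ^ 2 :=
        pow_le_pow_left₀ (le_min (abs_nonneg _) hb0.le) ((min_le_left _ _).trans h) 2
      linarith
    · rw [Set.indicator_of_mem (Set.mem_Ioi.2 h), div_mul_eq_mul_div]
      have := (le_div_iff₀ hGb).2 (h2 |X ω| b (ha.trans h.le) hb)
      linarith [sq_nonneg a]
  · simp only [Pi.add_apply]
    rw [integral_add (integrable_const _) hint, integral_const_mul]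
    simp

/-- Only values above `b` contribute, and `a ≤ b` keeps them where the indicator is active, so no
`a` term appears. -/
theorem integral_abs_sub_truncAt_le (hT : 0 < T) (hK : 0 < K) (hG : ∀ x, T ≤ x → 0 < G x)
    (h1 : ∀ x b, T ≤ b → b ≤ x → x * G b ≤ K * b * G x) (ha : T ≤ a) (hab : a ≤ b)
    (hi : Integrable (fun ω => (Set.Ioi a).indicator G |X ω|) μ) :
    ∫ ω, |X ω - truncAt b (X ω)| ∂μ ≤
      K * b / G b * ∫ ω, (Set.Ioi a).indicator G |X ω| ∂μ := by
  have hb := ha.trans hab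
  have hGb := hG b hb
  have hb0 := hT.trans_le hb
  rw [← integral_const_mul]
  refine integral_mono_of_nonneg (Eventually.of_forall fun ω => abs_nonneg _)
    (hi.const_mul _) (Eventually.of_forall fun ω => ?_)
  simp only
  rw [abs_sub_truncAt hb0.le]
  have := indicator_Ioi_nonneg hG ha |X ω|
  refine max_le ?_ (by positivity)
  rcases le_or_gt |X ω| b with h | h
  · exact (sub_nonpos.2 h).trans (by positivity)
  · rw [Set.indicator_of_mem (Set.mem_Ioi.2 (hab.trans_lt h)), div_mul_eq_mul_div]
    have := (le_div_iff₀ hGb).2 (h1 _ _ hb h.le)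
    linarith

end weight

/-- Real-valued form of uniform integrability in the Cesàro sense. -/
theorem CesaroUniformlyIntegrable.exists_forall_sum_integral_le {p : ℝ} {L : ℝ → ℝ}
    {X : ℕ → ℕ → Ω → ℝ} (hUI : CesaroUniformlyIntegrable μ p L X)
    (hX : ∀ n i : ℕ, 1 ≤ i → i ≤ n → Measurable (X n i)) {T : ℝ}
    (hG : ∀ x, T ≤ x → 0 < x ^ p * L (x ^ p))
    (hGm : ∀ a, T ≤ a → Measurable ((Set.Ioi a).indicator fun x => x ^ p * L (x ^ p)))
    {ε : ℝ} (hε : 0 < ε) :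
    ∃ a, T ≤ a ∧ ∀ n, 1 ≤ n →
      (∀ i ∈ Finset.Icc 1 n,
        Integrable (fun ω => (Set.Ioi a).indicator (fun x => x ^ p * L (x ^ p)) |X n i ω|) μ) ∧
      ∑ i ∈ Finset.Icc 1 n,
        ∫ ω, (Set.Ioi a).indicator (fun x => x ^ p * L (x ^ p)) |X n i ω| ∂μ ≤ n * ε := by
  obtain ⟨a, hsup, ha⟩ := ((hUI.eventually (ge_mem_nhds (ENNReal.ofReal_pos.2 hε))).and
    (eventually_ge_atTop T)).exists
  refine ⟨a, ha, fun n hn => ?_⟩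
  set g := (Set.Ioi a).indicator fun x => x ^ p * L (x ^ p) with hg
  have hg0 : ∀ x, 0 ≤ g x := indicator_Ioi_nonneg hG ha
  have hXm : ∀ i ∈ Finset.Icc 1 n, Measurable (X n i) := fun i hi =>
    hX n i (Finset.mem_Icc.1 hi).1 (Finset.mem_Icc.1 hi).2
  have hn0 : (n : ℝ≥0∞) ≠ 0 := by simpa using (by omega : n ≠ 0)
  have hlint : ∀ i ∈ Finset.Icc 1 n, ∫⁻ ω in {ω | a < |X n i ω|},
      ENNReal.ofReal (|X n i ω| ^ p * L (|X n i ω| ^ p)) ∂μ =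
      ∫⁻ ω, ENNReal.ofReal (g |X n i ω|) ∂μ := by
    intro i hi
    rw [← lintegral_indicator (measurableSet_lt measurable_const (hXm i hi).abs)]
    congr 1
    ext ω
    by_cases h : a < |X n i ω| <;> simp [hg, Set.indicator, h]
  have hsum : ∑ i ∈ Finset.Icc 1 n, ∫⁻ ω, ENNReal.ofReal (g |X n i ω|) ∂μ ≤
      ENNReal.ofReal (n * ε) := by
    rw [← Finset.sum_congr rfl hlint, ENNReal.ofReal_mul (by positivity), ENNReal.ofReal_natCast,
      mul_comm]
    have h1 := (le_iSup₂ (f := fun (n : ℕ) (_ : 1 ≤ n) => (n : ℝ≥0∞)⁻¹ *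
      ∑ i ∈ Finset.Icc 1 n, ∫⁻ ω in {ω | a < |X n i ω|},
          ENNReal.ofReal (|X n i ω| ^ p * L (|X n i ω| ^ p)) ∂μ) n hn).trans hsup
    rwa [mul_comm, ← div_eq_mul_inv, ENNReal.div_le_iff hn0 (by simp)] at h1
  have hint : ∀ i ∈ Finset.Icc 1 n, Integrable (fun ω => g |X n i ω|) μ := by
    intro i hi
    refine (lintegral_ofReal_ne_top_iff_integrable
      ((hGm a ha).comp (hXm i hi).abs).aestronglyMeasurable
      (Eventually.of_forall fun ω => hg0 _)).1 (ne_top_of_le_ne_top ENNReal.ofReal_ne_top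
        ((Finset.single_le_sum (fun _ _ => zero_le) hi).trans hsum))
  refine ⟨hint, ?_⟩
  rw [← ENNReal.ofReal_le_ofReal_iff (by positivity),
    ENNReal.ofReal_sum_of_nonneg fun i _ => integral_nonneg fun ω => hg0 _]
  refine le_of_eq_of_le (Finset.sum_congr rfl fun i hi => ?_) hsum
  exact ofReal_integral_eq_lintegral_ofReal (hint i hi) (Eventually.of_forall fun ω => hg0 _)

/-- Convergence of the normalized maxima, given a norming sequence `b`. -/
theorem tendstoInMeasure_maxAbsPartialSum_div [IsProbabilityMeasure μ] {X : ℕ → ℕ → Ω → ℝ} {C : ℝ}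
    (hX : ∀ n, ∀ i ∈ Finset.Icc 1 n, Measurable (X n i))
    (hXi : ∀ n, ∀ i ∈ Finset.Icc 1 n, Integrable (X n i) μ)
    (hH : ∀ n : ℕ, 1 ≤ n → ConditionH μ n (X n) C) {b : ℕ → ℝ} (hb : ∀ᶠ n in atTop, 0 < b n)
    (hV : Tendsto (fun n => (∑ i ∈ Finset.Icc 1 n, ∫ ω, truncAt (b n) (X n i ω) ^ 2 ∂μ) / b n ^ 2)
      atTop (𝓝 0))
    (hR : Tendsto (fun n => (∑ i ∈ Finset.Icc 1 n,
      ∫ ω, |X n i ω - truncAt (b n) (X n i ω)| ∂μ) / b n) atTop (𝓝 0)) :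
    TendstoInMeasure μ (fun (n : ℕ) (ω : Ω) =>
      maxAbsPartialSum (fun i => X n i ω - ∫ ω', X n i ω' ∂μ) 0 n / b n) atTop fun _ => (0 : ℝ) := by
  rw [tendstoInMeasure_iff_measureReal_norm]
  intro ε hε
  have hlim : Tendsto (fun n => (√(C * ((∑ i ∈ Finset.Icc 1 n,
      ∫ ω, truncAt (b n) (X n i ω) ^ 2 ∂μ) / b n ^ 2)) + 2 * ((∑ i ∈ Finset.Icc 1 n,
      ∫ ω, |X n i ω - truncAt (b n) (X n i ω)| ∂μ) / b n)) / ε) atTop (𝓝 0) := by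
    simpa using (((hV.const_mul C).sqrt).add (hR.const_mul 2)).div_const ε
  refine squeeze_zero' (Eventually.of_forall fun n => measureReal_nonneg) ?_ hlim
  filter_upwards [hb, eventually_ge_atTop 1] with n hbn hn
  have hM0 : ∀ ω, 0 ≤ maxAbsPartialSum (fun i => X n i ω - ∫ ω', X n i ω' ∂μ) 0 n :=
    fun ω => maxAbsPartialSum_nonneg _ _ _
  have hMi : Integrable
      (fun ω => maxAbsPartialSum (fun i => X n i ω - ∫ ω', X n i ω' ∂μ) 0 n) μ := by
    refine integrable_maxAbsPartialSum (fun i hi => ?_) fun i hi => ?_ <;>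
      rw [zero_add, zero_add] at hi
    · exact (hX n i hi).sub_const _
    · exact (hXi n i hi).sub (integrable_const _)
  have hle := (hH n hn).integral_maxAbsPartialSum_le hn (hX n) (hXi n) hbn
  have hmarkov := mul_meas_ge_le_integral_of_nonneg
    (Eventually.of_forall fun ω => div_nonneg (hM0 ω) hbn.le) (hMi.div_const (b n)) ε
  rw [integral_div] at hmarkov
  simp only [sub_zero, Real.norm_of_nonneg (div_nonneg (hM0 _) hbn.le)]
  rw [le_div_iff₀ hε, mul_comm]
  refine hmarkov.trans ?_
  rw [div_le_iff₀ hbn]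
  refine hle.trans_eq ?_
  -- `Real.sqrt_div'` asks only for a nonnegative denominator; the sign of `C` is not known.
  rw [mul_div_assoc', Real.sqrt_div' _ (sq_nonneg _), Real.sqrt_sq hbn.le]
  field_simp

end

/-! ### The weak law. -/

theorem mainTheorem11 {Ω : Type*} [MeasurableSpace Ω] (μ : Measure Ω) [IsProbabilityMeasure μ]
    (p : ℝ) (hp1 : 1 ≤ p) (hp2 : p < 2)
    (L Lt : ℝ → ℝ) (hL : SlowlyVarying L) (hLt : IsDeBruijnConjugate L Lt)
    (hLp : p = 1 → MonotoneOn L (Set.Ici 0) ∧ ∀ x : ℝ, 0 ≤ x → 1 ≤ L x)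
    (X : ℕ → ℕ → Ω → ℝ) (hX : ∀ n i : ℕ, 1 ≤ i → i ≤ n → Measurable (X n i))
    (hH : ∃ C : ℝ, ∀ n : ℕ, 1 ≤ n → ConditionH μ n (X n) C)
    (hUI : CesaroUniformlyIntegrable μ p L X) :
    (∀ n i : ℕ, 1 ≤ i → i ≤ n → Integrable (X n i) μ) ∧
    TendstoInMeasure μ
      (fun (n : ℕ) (ω : Ω) =>
        maxAbsPartialSum (fun i => X n i ω - ∫ ω', X n i ω' ∂μ) 0 n /
          ((n : ℝ) ^ (1 / p) * (Lt n) ^ (1 / p)))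
      atTop (fun _ => (0 : ℝ)) := by
  obtain ⟨T, hT, K, hK, hG, hGm, h2, h1⟩ := hL.exists_weight_bounds hp1 hp2 fun h => (hLp h).1
  obtain ⟨hbT, hbn, hbs⟩ := hLt.norming hp1 hp2 hL
  replace hbT := hbT.comp (tendsto_natCast_atTop_atTop (R := ℝ))
  replace hbn := (tendsto_natCast_atTop_atTop (R := ℝ)).eventually hbn
  replace hbs := hbs.comp (tendsto_natCast_atTop_atTop (R := ℝ))
  simp only [Function.comp_def] at hbT hbs
  have hcui := fun ε (hε : 0 < ε) => hUI.exists_forall_sum_integral_le hX hG hGm hε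
  set G : ℝ → ℝ := fun x => x ^ p * L (x ^ p) with hGdef
  set b : ℕ → ℝ := fun n => (n : ℝ) ^ (1 / p) * Lt n ^ (1 / p) with hb
  change ∀ᶠ n : ℕ in atTop, (n : ℝ) ≤ 2 * G (b n) at hbn
  have hint : ∀ n i : ℕ, 1 ≤ i → i ≤ n → Integrable (X n i) μ := by
    obtain ⟨a, ha, hs⟩ := hcui 1 one_pos
    intro n i hi hin
    exact integrable_of_integrable_weight hT hK hG h1 ha (hX n i hi hin)
      ((hs n (hi.trans hin)).1 i (Finset.mem_Icc.2 ⟨hi, hin⟩))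
  have hX' : ∀ n, ∀ i ∈ Finset.Icc 1 n, Measurable (X n i) := fun n i hi =>
    hX n i (Finset.mem_Icc.1 hi).1 (Finset.mem_Icc.1 hi).2
  have hint' : ∀ n, ∀ i ∈ Finset.Icc 1 n, Integrable (X n i) μ := fun n i hi =>
    hint n i (Finset.mem_Icc.1 hi).1 (Finset.mem_Icc.1 hi).2
  have hb0 : ∀ᶠ n in atTop, 0 < b n := hbT.eventually_gt_atTop 0
  refine ⟨hint, ?_⟩
  obtain ⟨C, hC⟩ := hH
  refine tendstoInMeasure_maxAbsPartialSum_div hX' hint' hC hb0 ?_ ?_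
  · rw [tendsto_order]
    refine ⟨fun c hc => ?_, fun η hη => ?_⟩
    · filter_upwards [hb0] with n hn
      exact hc.trans_le (div_nonneg (Finset.sum_nonneg fun i _ =>
        integral_nonneg fun ω => sq_nonneg _) (sq_nonneg _))
    -- With `n ≤ 2 * G (b n)`, this choice makes the part above `a` at most `b n ^ 2 * (η / 2)`; the
    -- other half absorbs `n * a ^ 2`.
    · obtain ⟨a, ha, hs⟩ := hcui (η / (4 * K)) (by positivity)
      have hlim := hbs.const_mul (a ^ 2)
      rw [mul_zero] at hlim
      filter_upwards [hb0, hbT.eventually_ge_atTop T, hbn, eventually_ge_atTop 1,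
        hlim.eventually (gt_mem_nhds (half_pos hη))] with n hn hnT hnG hn1 hsmall
      have hGb := hG _ hnT
      change 0 < G (b n) at hGb
      obtain ⟨hi, hsum⟩ := hs n hn1
      have hle : ∑ i ∈ Finset.Icc 1 n, ∫ ω, truncAt (b n) (X n i ω) ^ 2 ∂μ ≤
          n * a ^ 2 + K * b n ^ 2 / G (b n) * (n * (η / (4 * K))) := by
        refine (Finset.sum_le_sum fun i hi' =>
          integral_truncAt_sq_le hT hK hG h2 ha hnT (hi i hi')).trans ?_
        rw [Finset.sum_add_distrib, ← Finset.mul_sum]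
        simp only [Finset.sum_const, Nat.card_Icc, add_tsub_cancel_right, nsmul_eq_mul]
        gcongr
      have hle2 : K * b n ^ 2 / G (b n) * (n * (η / (4 * K))) ≤ b n ^ 2 * (η / 2) := by
        calc _ ≤ K * b n ^ 2 / G (b n) * (2 * G (b n) * (η / (4 * K))) := by gcongr
          _ = _ := by field_simp; ring
      have hb2 : 0 < b n ^ 2 := by positivity
      rw [div_lt_iff₀ hb2]
      rw [mul_div_assoc', div_lt_iff₀ hb2] at hsmall
      linarith
  · rw [tendsto_order]
    refine ⟨fun c hc => ?_, fun η hη => ?_⟩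
    · filter_upwards [hb0] with n hn
      exact hc.trans_le (div_nonneg (Finset.sum_nonneg fun i _ =>
        integral_nonneg fun ω => abs_nonneg _) hn.le)
    · obtain ⟨a, ha, hs⟩ := hcui (η / (4 * K)) (by positivity)
      filter_upwards [hb0, hbT.eventually_ge_atTop a, hbn, eventually_ge_atTop 1]
        with n hn hna hnG hn1
      have hGb := hG _ (ha.trans hna)
      change 0 < G (b n) at hGb
      obtain ⟨hi, hsum⟩ := hs n hn1
      have hle : ∑ i ∈ Finset.Icc 1 n, ∫ ω, |X n i ω - truncAt (b n) (X n i ω)| ∂μ ≤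
          K * b n / G (b n) * (n * (η / (4 * K))) := by
        refine (Finset.sum_le_sum fun i hi' =>
          integral_abs_sub_truncAt_le hT hK hG h1 ha hna (hi i hi')).trans ?_
        rw [← Finset.mul_sum]
        gcongr
      have hle2 : K * b n / G (b n) * (n * (η / (4 * K))) ≤ b n * (η / 2) := by
        calc _ ≤ K * b n / G (b n) * (2 * G (b n) * (η / (4 * K))) := by gcongr
          _ = _ := by field_simp; ring
      rw [div_lt_iff₀ hn]
      nlinarith
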